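/- Let $K$ be a field, $d\ge 2$, $\mathbf t=(t_1,\dots,t_{d-1})\in\mathbb Z_{\ge1}^{d-1}$ and $S=K[x_1,\dots,x_n]$. A monomial $x_{i_1}\cdots x_{i_\ell}\in S$ with $i_1\le\dots\le i_\ell$ and $\ell\le d$ is called *$\mathbf t$-spread* if $i_{k+1}-i_k\ge t_k$ for all $k=1,\dots,\ell-1$. A monomial ideal $I\subset S$ is *$\mathbf t$-spread strongly stable* if all its minimal monomial generators are $\mathbf t$-spread and, for every $\mathbf t$-spread monomial $v\in I$ and all $j<i$ such that $x_i\mid v$ and $x_j(v/x_i)$ is $\mathbf t$-spread, one has $x_j(v/x_i)\in I$. Let $u=x_{j_1}\cdots x_{j_d}\in S$ be a $\mathbf t$-spread monomial with $1\le j_1<\dots<j_{d-1}<j_d=n$, and let $I=B_{\mathbf t}(u)$ be the smallest $\mathbf t$-spread strongly stable ideal of $S$ containing $u$; it is a squarefree monomial ideal. Let $I=P_1\cap\dots\cap P_m$ be its minimal primary decomposition; here $P_1,\dots,P_m$ are prime ideals generated by variables (the minimal primes of $I$). For $k\ge1$ let $I^{(k)}=P_1^k\cap\dots\cap P_m^k$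 be the $k$th symbolic power of $I$. For an ideal $J\subset S$ let $\operatorname{Ass}(J)$ denote the set of associated primes of $S/J$. Then the following statements are equivalent. (a) $I$ is normally torsionfree, i.e. $\operatorname{Ass}(I^k)\subseteq\operatorname{Ass}(I)$ for all $k\ge1$. (b) $I^{(k)}=I^k$ for all integers $k\ge1$. (c) $j_i\le t_1+\dots+t_i$ for all $i=1,\dots,d-1$. -/

import Mathlib

/-! The variables of `S = K[x₁, …, xₙ]` are indexed by `Fin n`, so the index `j : Fin n` stands for
the variable `x_{j+1}`. The spread vector `(t₁, …, t_{d-1})` is `t : Fin (d - 1) → ℕ`, with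
`t k` standing for `t_{k+1}`. Monomials are represented by their exponent vectors. -/

namespace VectorSpread

open MvPolynomial

noncomputable section

/-- The exponent vector of the monomial `x_{j₁} x_{j₂} ⋯ x_{j_ℓ}`. -/
def expo {n ℓ : ℕ} (j : Fin ℓ → Fin n) : Fin n →₀ ℕ :=
  ∑ k, Finsupp.single (j k) 1

/-- The gap condition `j_{k+1} - j_k ≥ t_k` for `k = 1, …, ℓ - 1`, where `ℓ ≤ d`. -/
def HasGaps {n d ℓ : ℕ} (t : Fin (d - 1) → ℕ) (hℓ : ℓ ≤ d) (j : Fin ℓ → Fin n) : Prop :=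
  ∀ (k : ℕ) (hk : k + 1 < ℓ),
    (j ⟨k, by omega⟩ : ℕ) + t ⟨k, by omega⟩ ≤ (j ⟨k + 1, hk⟩ : ℕ)

/-- The monomial with exponent vector `m` is `t`-spread: it is `x_{j₁} ⋯ x_{j_ℓ}` with `ℓ ≤ d`,
`j₁ ≤ ⋯ ≤ j_ℓ` and `j_{k+1} - j_k ≥ t_k` for all `k = 1, …, ℓ - 1`. -/
def IsSpread {n d : ℕ} (t : Fin (d - 1) → ℕ) (m : Fin n →₀ ℕ) : Prop :=
  ∃ (ℓ : ℕ) (hℓ : ℓ ≤ d) (j : Fin ℓ → Fin n), Monotone j ∧ HasGaps t hℓ j ∧ m = expo j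

variable {K : Type*} [Field K] {n d : ℕ}

/-- `I` is a monomial ideal: it is generated by monomials. -/
def IsMonomialIdeal (I : Ideal (MvPolynomial (Fin n) K)) : Prop :=
  ∃ A : Set (Fin n →₀ ℕ), I = Ideal.span ((fun m => monomial m (1 : K)) '' A)

/-- The (exponent vectors of the) minimal monomial generators `G(I)` of a monomial ideal: the
monomials of `I` that are minimal with respect to divisibility. -/
def minGens (I : Ideal (MvPolynomial (Fin n) K)) : Set (Fin n →₀ ℕ) :=
  {m | Minimal (fun m' => monomial m' (1 : K) ∈ I) m}

/-- `I` is a `t`-spread monomial ideal. -/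
def IsSpreadIdeal (t : Fin (d - 1) → ℕ) (I : Ideal (MvPolynomial (Fin n) K)) : Prop :=
  IsMonomialIdeal I ∧ ∀ m ∈ minGens I, IsSpread t m

/-- `I` is a `t`-spread strongly stable ideal. -/
def IsSpreadStronglyStable (t : Fin (d - 1) → ℕ) (I : Ideal (MvPolynomial (Fin n) K)) : Prop :=
  IsSpreadIdeal t I ∧
    ∀ m : Fin n →₀ ℕ, IsSpread t m → monomial m (1 : K) ∈ I →
      ∀ i j : Fin n, j < i → i ∈ m.support →
        IsSpread t (m - Finsupp.single i 1 + Finsupp.single j 1) →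
          monomial (m - Finsupp.single i 1 + Finsupp.single j 1) (1 : K) ∈ I

variable (K) in
/-- The principal `t`-spread Borel ideal `B_t(u)`: the smallest `t`-spread strongly stable ideal
that contains the monomial `u`. -/
def borel (t : Fin (d - 1) → ℕ) (u : Fin n →₀ ℕ) : Ideal (MvPolynomial (Fin n) K) :=
  sInf {I | IsSpreadStronglyStable t I ∧ monomial u (1 : K) ∈ I}

/-- `I` is normally torsionfree: `Ass(I^k) ⊆ Ass(I)` for all `k ≥ 1`, where `Ass(J)` is the set of
associated primes of `S/J`. -/
def NormallyTorsionfree (I : Ideal (MvPolynomial (Fin n) K)) : Prop :=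
  ∀ k : ℕ, 1 ≤ k →
    associatedPrimes (MvPolynomial (Fin n) K) (MvPolynomial (Fin n) K ⧸ I ^ k) ⊆
      associatedPrimes (MvPolynomial (Fin n) K) (MvPolynomial (Fin n) K ⧸ I)

/-- The `k`th symbolic power of a squarefree monomial ideal `I`: the intersection of the `k`th
powers of the primes `P_F` in the minimal primary decomposition of `I`. As `I` is radical, these
are the minimal primes of `I`. -/
def symbolicPower (I : Ideal (MvPolynomial (Fin n) K)) (k : ℕ) : Ideal (MvPolynomial (Fin n) K) :=
  ⨅ P ∈ I.minimalPrimes, P ^ k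

end

end VectorSpread

namespace VectorSpread

open MvPolynomial

/-! ### Associated primes of powers and symbolic powers in Noetherian rings -/

section AssociatedPrimes

variable {R : Type*} [CommRing R] [IsNoetherianRing R]

/-! The generators of `I` are the `t`-spread monomials of degree `d` with indices componentwise at
most those of `u`. Since `I` is radical, (a) gives equality of ordinary and symbolic powers, by
localizing at minimal primes. Conversely, minimal primes are generated by variables, so their powers
are primary and (b) excludes embedded primes.

For (c) ⇒ (b), subtract `t₁ + ⋯ + t_k` from the index at place `k + 1`. Generators become weakly
increasing chains in a grid. A monomial of `I^(N)` has weight at least `N` on every set of variables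
meeting all generators, so every cut has capacity at least `N`, and max-flow min-cut (`exists_cut`,
`flowPos`) yields `N` chains. Condition (c) forces different places to use disjoint blocks of
variables, so grid capacities are exponents and the product of the `N` generators divides the
monomial (`exists_packing`).

If (c) fails, there are generators `μqr`, `μpr`, `μpq`. A prime containing all three contains `μ` or
two of `p, q, r`, so `μ²pqr` lies in `I^(2)`. Its degree `2d - 1` is too small for `I²`. -/

theorem mem_associatedPrimes_quotient_iff {J Q : Ideal R} :
    Q ∈ associatedPrimes R (R ⧸ J) ↔ Q.IsPrime ∧ ∃ f, ∀ r, r ∈ Q ↔ r * f ∈ J := by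
  rw [AssociatedPrimes.mem_iff, isAssociatedPrime_iff]
  refine and_congr_right fun _ => ⟨?_, ?_⟩
  · rintro ⟨x, hx⟩
    obtain ⟨f, rfl⟩ := Ideal.Quotient.mk_surjective x
    refine ⟨f, fun r => ?_⟩
    rw [hx, Submodule.mem_colon_singleton, Submodule.mem_bot, Algebra.smul_def,
      Ideal.Quotient.algebraMap_eq, ← map_mul, Ideal.Quotient.eq_zero_iff_mem]
  · rintro ⟨f, hf⟩
    refine ⟨Ideal.Quotient.mk J f, Ideal.ext fun r => ?_⟩
    rw [hf, Submodule.mem_colon_singleton, Submodule.mem_bot, Algebra.smul_def,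
      Ideal.Quotient.algebraMap_eq, ← map_mul, Ideal.Quotient.eq_zero_iff_mem]

theorem minimalPrimes_subset_associatedPrimes_quotient (I : Ideal R) :
    I.minimalPrimes ⊆ associatedPrimes R (R ⧸ I) := by
  have h := Module.associatedPrimes.minimalPrimes_annihilator_subset_associatedPrimes R (R ⧸ I)
  rwa [Ideal.annihilator_quotient] at h

/-- If the `k`th power of `I` is the intersection of the `k`th powers of the minimal primes of `I`,
and these are primary, then `I ^ k` has no embedded primes. -/
theorem associatedPrimes_pow_subset_minimalPrimes {I : Ideal R} {k : ℕ}
    (h : ⨅ P ∈ I.minimalPrimes, P ^ k ≤ I ^ k)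
    (hprim : ∀ P ∈ I.minimalPrimes, ∀ f g, f * g ∈ P ^ k → f ∈ P ∨ g ∈ P ^ k) :
    associatedPrimes R (R ⧸ I ^ k) ⊆ I.minimalPrimes := by
  intro Q hQ
  obtain ⟨hQp, f, hf⟩ := mem_associatedPrimes_quotient_iff.1 hQ
  have hfI : f ∉ I ^ k := fun hfI =>
    hQp.ne_top ((Ideal.eq_top_iff_one Q).2 ((hf 1).2 (by rwa [one_mul])))
  have hex : ∃ P ∈ I.minimalPrimes, f ∉ P ^ k := by
    by_contra! hcon
    exact hfI (h (by simpa [Submodule.mem_iInf] using hcon))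
  obtain ⟨P, hP, hfP⟩ := hex
  -- `Q` multiplies `f` into the primary ideal `P ^ k`, which omits `f`; hence `Q` lies in its
  -- radical `P`.
  have hQP : Q ≤ P := fun r hr => (hprim P hP r f
    (Ideal.pow_right_mono hP.1.2 k ((hf r).1 hr))).resolve_right hfP
  have hIQ : I ≤ Q := by
    refine hQp.le_of_pow_le (n := k) fun r hr => (hf r).2 (Ideal.mul_mem_right _ _ hr)
  rwa [le_antisymm hQP (hP.2 ⟨hQp, hIQ⟩ hQP)]

theorem associatedPrimes_subset_minimalPrimes_of_isRadical {I : Ideal R} (hI : I.IsRadical) :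
    associatedPrimes R (R ⧸ I) ⊆ I.minimalPrimes := by
  have h := associatedPrimes_pow_subset_minimalPrimes (I := I) (k := 1) (by
    simp only [pow_one]
    rw [← sInf_eq_iInf, Ideal.sInf_minimalPrimes]
    exact hI) (by
    intro P hP f g hfg
    rw [pow_one] at hfg ⊢
    exact hP.1.1.mem_or_mem hfg)
  rwa [pow_one] at h

/-- For a radical ideal `I` and a minimal prime `Q` of `I`, the localizations of `I` and `Q` at `Q`
agree. -/
theorem exists_notMem_span_singleton_mul_le {I : Ideal R} (hI : I.IsRadical) {Q : Ideal R}
    (hQ : Q ∈ I.minimalPrimes) : ∃ s, s ∉ Q ∧ Ideal.span {s} * Q ≤ I := by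
  classical
  have hfin := Ideal.finite_minimalPrimes_of_isNoetherianRing R I
  -- There are finitely many minimal primes, so some `s` outside `Q` lies in all the others; then
  -- `sQ` lies in every minimal prime.
  have hnot : ¬ (hfin.toFinset.erase Q).inf id ≤ Q := by
    rw [hQ.1.1.inf_le']
    rintro ⟨P, hP, hle⟩
    rw [Finset.mem_erase, Set.Finite.mem_toFinset] at hP
    exact hP.1 (le_antisymm hle (hQ.2 hP.2.1 hle))
  obtain ⟨s, hs, hsQ⟩ := SetLike.not_le_iff_exists.1 hnot
  refine ⟨s, hsQ, ?_⟩
  rw [← hI.radical, ← Ideal.sInf_minimalPrimes]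
  refine le_sInf fun P hP => ?_
  rw [Ideal.span_singleton_mul_le_iff]
  intro z hz
  by_cases hPQ : P = Q
  · exact hPQ ▸ Ideal.mul_mem_left _ _ hz
  · refine Ideal.mul_mem_right _ _ ?_
    exact (Finset.inf_le (f := id) (Finset.mem_erase.2 ⟨hPQ, hfin.mem_toFinset.2 hP⟩)) hs

/-- If the powers of a radical ideal have no embedded primes, they agree with the symbolic
powers. -/
theorem iInf_minimalPrimes_pow_le_pow {I : Ideal R} (hI : I.IsRadical) {k : ℕ}
    (h : associatedPrimes R (R ⧸ I ^ k) ⊆ associatedPrimes R (R ⧸ I)) :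
    ⨅ P ∈ I.minimalPrimes, P ^ k ≤ I ^ k := by
  intro f hf
  by_contra hfI
  obtain ⟨Q, hQ, hle⟩ := exists_le_isAssociatedPrime_of_isNoetherianRing R
    (Ideal.Quotient.mk (I ^ k) f) (by rwa [Ne, Ideal.Quotient.eq_zero_iff_mem])
  have hQm := associatedPrimes_subset_minimalPrimes_of_isRadical hI (h hQ)
  obtain ⟨s, hs, hsQ⟩ := exists_notMem_span_singleton_mul_le hI hQm
  -- Since `f ∈ Q ^ k` and `sQ ⊆ I`, `s ^ k` annihilates the class of `f`, so it would lie in `Q`.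
  refine hs (hQm.1.1.mem_of_pow_mem k (hle ?_))
  rw [Submodule.mem_colon_singleton, Submodule.mem_bot, Algebra.smul_def,
    Ideal.Quotient.algebraMap_eq, ← map_mul, Ideal.Quotient.eq_zero_iff_mem]
  refine Ideal.pow_right_mono hsQ k ?_
  rw [mul_pow]
  refine Ideal.mul_mem_mul (Ideal.pow_mem_pow (Ideal.mem_span_singleton_self s) k) ?_
  simp only [Submodule.mem_iInf] at hf
  exact hf Q hQm

end AssociatedPrimes

/-! ### Monomial ideals and primes generated by variables -/

section VariableIdeals

variable {σ K : Type*} [Field K]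

noncomputable section

variable (K) in
/-- The ideal generated by the monomials with exponent vectors in `A`. -/
def monomialSpan (A : Set (σ →₀ ℕ)) : Ideal (MvPolynomial σ K) :=
  Ideal.span ((fun m => monomial m (1 : K)) '' A)

theorem mem_monomialSpan_iff {A : Set (σ →₀ ℕ)} {f : MvPolynomial σ K} :
    f ∈ monomialSpan K A ↔ ∀ m ∈ f.support, ∃ a ∈ A, a ≤ m :=
  mem_ideal_span_monomial_image

theorem monomial_mem_monomialSpan_iff {A : Set (σ →₀ ℕ)} {m : σ →₀ ℕ} :
    monomial m (1 : K) ∈ monomialSpan K A ↔ ∃ a ∈ A, a ≤ m := by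
  classical
  rw [mem_monomialSpan_iff, support_monomial, if_neg one_ne_zero]
  simp

theorem monomial_mem_of_le {J : Ideal (MvPolynomial σ K)} {a m : σ →₀ ℕ}
    (ha : monomial a (1 : K) ∈ J) (h : a ≤ m) : monomial m (1 : K) ∈ J := by
  obtain ⟨b, rfl⟩ := exists_add_of_le h
  rw [← one_mul (1 : K), ← monomial_mul]
  exact Ideal.mul_mem_right _ _ ha

theorem exists_X_mem_of_monomial_mem {P : Ideal (MvPolynomial σ K)} (hP : P.IsPrime)
    {m : σ →₀ ℕ} (hm : monomial m (1 : K) ∈ P) : ∃ i, 1 ≤ m i ∧ X i ∈ P := by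
  rw [monomial_eq, C_1, one_mul, Finsupp.prod, hP.prod_mem_iff] at hm
  obtain ⟨i, hi, h⟩ := hm
  exact ⟨i, Nat.one_le_iff_ne_zero.2 (Finsupp.mem_support_iff.1 hi), hP.mem_of_pow_mem _ h⟩

variable (K) in
/-- The ideal generated by the variables `X i`, `i ∈ s`. -/
def varIdeal (s : Finset σ) : Ideal (MvPolynomial σ K) :=
  Ideal.span (X '' (s : Set σ))

variable [DecidableEq σ]

variable (K) in
/-- The map `X i ↦ X i * T` for `i ∈ s` and `X i ↦ X i` otherwise. -/
def gradingHom (s : Finset σ) : MvPolynomial σ K →ₐ[K] Polynomial (MvPolynomial σ K) :=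
  aeval fun i => Polynomial.C (X i) * if i ∈ s then Polynomial.X else 1

theorem varIdeal_pow_le_comap (s : Finset σ) (k : ℕ) :
    varIdeal K s ^ k ≤ (Ideal.span {Polynomial.X ^ k}).comap (gradingHom K s) := by
  rw [← Ideal.span_singleton_pow]
  refine le_trans (Ideal.pow_right_mono (J := (Ideal.span {Polynomial.X}).comap (gradingHom K s))
    ?_ k) (Ideal.le_comap_pow _ _)
  rw [varIdeal, Ideal.span_le]
  rintro _ ⟨i, hi, rfl⟩
  rw [SetLike.mem_coe, Ideal.mem_comap, Ideal.mem_span_singleton, gradingHom, aeval_X,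
    if_pos (by simpa using hi)]
  exact dvd_mul_left _ _

variable [Fintype σ]

theorem gradingHom_monomial (s : Finset σ) (m : σ →₀ ℕ) (a : K) :
    gradingHom K s (monomial m a) =
      Polynomial.C (monomial m a) * Polynomial.X ^ ∑ i ∈ s, m i := by
  rw [gradingHom, aeval_monomial, Finsupp.prod_fintype _ _ (by simp), monomial_eq,
    Finsupp.prod_fintype _ _ (by simp), map_mul, map_prod]
  simp only [mul_pow, Finset.prod_mul_distrib, map_pow, ite_pow, one_pow]
  rw [Finset.prod_ite_mem, Finset.univ_inter, Finset.prod_pow_eq_pow_sum, ← mul_assoc]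
  rfl

/-- A monomial `m` lands in the single `T`-degree given by its degree in the variables of `s`, so no
cancellation occurs and coefficients can be read off. -/
theorem coeff_coeff_gradingHom (s : Finset σ) (f : MvPolynomial σ K) (m : σ →₀ ℕ) :
    ((gradingHom K s f).coeff (∑ i ∈ s, m i)).coeff m = f.coeff m := by
  induction f using MvPolynomial.induction_on' with
  | add p q hp hq => rw [map_add, Polynomial.coeff_add, coeff_add, hp, hq, coeff_add]
  | monomial u a =>
    rw [gradingHom_monomial, Polynomial.coeff_C_mul_X_pow]
    by_cases h : u = m
    · simp [h]
    · split_ifs <;> simp [coeff_monomial, h]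

theorem monomial_mem_varIdeal_pow {s : Finset σ} {m : σ →₀ ℕ} {k : ℕ} (a : K)
    (h : k ≤ ∑ i ∈ s, m i) : monomial m a ∈ varIdeal K s ^ k := by
  refine Ideal.pow_le_pow_right h ?_
  rw [monomial_eq, Finsupp.prod_fintype _ _ (by simp),
    ← Finset.prod_mul_prod_compl s]
  refine Ideal.mul_mem_left _ _ (Ideal.mul_mem_right _ _ ?_)
  rw [← Finset.prod_pow_eq_pow_sum]
  exact Ideal.prod_mem_prod fun i hi =>
    Ideal.pow_mem_pow (Ideal.subset_span (Set.mem_image_of_mem X hi)) _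

theorem le_sum_of_X_pow_dvd {s : Finset σ} {f : MvPolynomial σ K} {k : ℕ}
    (h : Polynomial.X ^ k ∣ gradingHom K s f) {m : σ →₀ ℕ} (hm : m ∈ f.support) :
    k ≤ ∑ i ∈ s, m i := by
  by_contra! hlt
  rw [mem_support_iff, ← coeff_coeff_gradingHom s, Polynomial.X_pow_dvd_iff.1 h _ hlt] at hm
  exact hm (coeff_zero _)

/-- The order of vanishing along `s` becomes divisibility by powers of `T`. Primality of the ideal
and primariness of its powers both reduce to `T` being a prime element. -/
theorem mem_varIdeal_pow_iff_dvd {s : Finset σ} {f : MvPolynomial σ K} {k : ℕ} :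
    f ∈ varIdeal K s ^ k ↔ Polynomial.X ^ k ∣ gradingHom K s f := by
  refine ⟨fun h => Ideal.mem_span_singleton.1 (varIdeal_pow_le_comap s k h), fun h => ?_⟩
  rw [f.as_sum]
  exact Ideal.sum_mem _ fun m hm => monomial_mem_varIdeal_pow _ (le_sum_of_X_pow_dvd h hm)

theorem le_sum_of_mem_varIdeal_pow {s : Finset σ} {f : MvPolynomial σ K} {k : ℕ}
    (h : f ∈ varIdeal K s ^ k) {m : σ →₀ ℕ} (hm : m ∈ f.support) : k ≤ ∑ i ∈ s, m i :=
  le_sum_of_X_pow_dvd (mem_varIdeal_pow_iff_dvd.1 h) hm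

theorem varIdeal_isPrime (s : Finset σ) : (varIdeal K s).IsPrime := by
  have h : varIdeal K s = (Ideal.span {Polynomial.X}).comap (gradingHom K s) := by
    ext f
    rw [Ideal.mem_comap, Ideal.mem_span_singleton]
    simpa using mem_varIdeal_pow_iff_dvd (s := s) (f := f) (k := 1)
  rw [h]
  have : (Ideal.span {(Polynomial.X : Polynomial (MvPolynomial σ K))}).IsPrime :=
    (Ideal.span_singleton_prime Polynomial.X_ne_zero).2 Polynomial.prime_X
  exact Ideal.comap_isPrime _ _

/-- Powers of ideals generated by variables are primary. -/
theorem mem_or_mem_of_mul_mem_varIdeal_pow {s : Finset σ} {f g : MvPolynomial σ K} {k : ℕ}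
    (h : f * g ∈ varIdeal K s ^ k) : f ∈ varIdeal K s ∨ g ∈ varIdeal K s ^ k := by
  refine or_iff_not_imp_left.2 fun hf => ?_
  rw [← pow_one (varIdeal K s), mem_varIdeal_pow_iff_dvd, pow_one] at hf
  rw [mem_varIdeal_pow_iff_dvd, map_mul] at h
  exact mem_varIdeal_pow_iff_dvd.2 (Polynomial.prime_X.pow_dvd_of_dvd_mul_left k hf h)

theorem monomialSpan_le_varIdeal {A : Set (σ →₀ ℕ)} {s : Finset σ}
    (h : ∀ a ∈ A, ∃ i ∈ s, 1 ≤ a i) : monomialSpan K A ≤ varIdeal K s := by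
  rw [monomialSpan, Ideal.span_le]
  rintro _ ⟨a, ha, rfl⟩
  obtain ⟨i, hi, hia⟩ := h a ha
  rw [SetLike.mem_coe, ← pow_one (varIdeal K s)]
  exact monomial_mem_varIdeal_pow _ (hia.trans (Finset.single_le_sum (by simp) hi))

/-- The minimal primes of a monomial ideal are generated by variables. -/
theorem exists_eq_varIdeal_of_mem_minimalPrimes {A : Set (σ →₀ ℕ)} {P : Ideal (MvPolynomial σ K)}
    (hP : P ∈ (monomialSpan K A).minimalPrimes) : ∃ s, P = varIdeal K s := by
  classical
  let s : Finset σ := Finset.univ.filter fun i => X i ∈ P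
  have hsP : varIdeal K s ≤ P := by
    rw [varIdeal, Ideal.span_le]
    rintro _ ⟨i, hi, rfl⟩
    simpa [s] using hi
  refine ⟨s, le_antisymm (hP.2 ⟨varIdeal_isPrime s, monomialSpan_le_varIdeal fun a ha => ?_⟩ hsP)
    hsP⟩
  obtain ⟨i, hi, hiP⟩ := exists_X_mem_of_monomial_mem hP.1.1
    (hP.1.2 (Ideal.subset_span ⟨a, ha, rfl⟩))
  exact ⟨i, by simpa [s] using hiP, hi⟩

/-- Squarefree monomial ideals are radical. -/
theorem monomialSpan_isRadical {A : Set (σ →₀ ℕ)} (hA : ∀ a ∈ A, ∀ i, a i ≤ 1) :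
    (monomialSpan K A).IsRadical := by
  intro f hf
  rw [mem_monomialSpan_iff]
  intro m hm
  by_contra! hcon
  -- A squarefree generator not dividing `m` involves a variable outside the support of `m`. So the
  -- prime generated by those variables contains the ideal, yet it misses `m`.
  have hle : monomialSpan K A ≤ varIdeal K m.supportᶜ := by
    refine monomialSpan_le_varIdeal fun a ha => ?_
    by_contra! h
    refine hcon a ha fun i => ?_
    by_cases hi : i ∈ m.support
    · exact (hA a ha i).trans (Nat.one_le_iff_ne_zero.2 (Finsupp.mem_support_iff.1 hi))
    · have := h i (Finset.mem_compl.2 hi)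
      omega
  have hfm := (varIdeal_isPrime _).radical_le_iff.2 hle hf
  rw [← pow_one (varIdeal K _)] at hfm
  have := le_sum_of_mem_varIdeal_pow hfm hm
  rw [Finset.sum_eq_zero fun i hi => by simpa using hi] at this
  omega

/-- If the `k`th power of a monomial ideal is the intersection of the `k`th powers of its minimal
primes, its associated primes are associated primes of the ideal. -/
theorem associatedPrimes_pow_subset_of_iInf_pow_le {A : Set (σ →₀ ℕ)} {k : ℕ}
    (h : ⨅ P ∈ (monomialSpan K A).minimalPrimes, P ^ k ≤ monomialSpan K A ^ k) :
    associatedPrimes (MvPolynomial σ K) (MvPolynomial σ K ⧸ monomialSpan K A ^ k) ⊆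
      associatedPrimes (MvPolynomial σ K) (MvPolynomial σ K ⧸ monomialSpan K A) := by
  refine (associatedPrimes_pow_subset_minimalPrimes h fun P hP f g hfg => ?_).trans
    (minimalPrimes_subset_associatedPrimes_quotient _)
  obtain ⟨s, rfl⟩ := exists_eq_varIdeal_of_mem_minimalPrimes hP
  exact mem_or_mem_of_mul_mem_varIdeal_pow hfg

end

end VariableIdeals

end VectorSpread

namespace VectorSpread

open MvPolynomial

/-! ### Generators of the principal vector-spread Borel ideal -/

section Generators

variable {n d : ℕ}

theorem HasGaps.strictMono {ℓ : ℕ} {t : Fin (d - 1) → ℕ} (ht : ∀ k, 1 ≤ t k) {hℓ : ℓ ≤ d}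
    {i : Fin ℓ → Fin n} (hi : HasGaps t hℓ i) : StrictMono i := by
  have key : ∀ (m k : ℕ) (h : k + m + 1 < ℓ), i ⟨k, by omega⟩ < i ⟨k + m + 1, h⟩ := by
    intro m k
    induction m with
    | zero =>
      intro h
      have h₁ := hi k h
      have h₂ := ht ⟨k, by omega⟩
      exact Fin.lt_def.2 (by simpa using (by omega : _ < _))
    | succ m ih =>
      intro h
      refine (ih (by omega)).trans ?_
      have h₁ := hi (k + m + 1) h
      have h₂ := ht ⟨k + m + 1, by omega⟩
      exact Fin.lt_def.2 (by simpa [← add_assoc] using (by omega : _ < _))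
  intro a b hab
  obtain ⟨m, hm⟩ := Nat.exists_eq_add_of_lt (Fin.lt_def.1 hab)
  have h := key m a (by omega)
  rwa [show (⟨(a : ℕ) + m + 1, by omega⟩ : Fin ℓ) = b from Fin.ext hm.symm] at h

theorem expo_apply {ℓ : ℕ} (i : Fin ℓ → Fin n) (c : Fin n) :
    expo i c = (Finset.univ.filter fun k => i k = c).card := by
  rw [expo, Finsupp.finsetSum_apply, Finset.card_filter]
  exact Finset.sum_congr rfl fun k _ => by rw [Finsupp.single_apply]

theorem sum_expo {ℓ : ℕ} (i : Fin ℓ → Fin n) (s : Finset (Fin n)) :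
    ∑ c ∈ s, expo i c = (Finset.univ.filter fun k => i k ∈ s).card := by
  rw [Finset.card_eq_sum_card_fiberwise (f := i) (t := s) (by intro k; simp)]
  refine Finset.sum_congr rfl fun c hc => ?_
  rw [expo_apply, Finset.filter_filter]
  congr 1
  ext k
  simp only [Finset.mem_filter, Finset.mem_univ, true_and]
  exact ⟨fun h => ⟨h ▸ hc, h⟩, fun h => h.2⟩

theorem degree_expo {ℓ : ℕ} (i : Fin ℓ → Fin n) : (expo i).degree = ℓ := by
  rw [Finsupp.degree_eq_sum, sum_expo]
  simp

theorem expo_le_one {ℓ : ℕ} {i : Fin ℓ → Fin n} (hi : Function.Injective i) (c : Fin n) :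
    expo i c ≤ 1 := by
  rw [expo_apply, Finset.card_le_one]
  intro a ha b hb
  simp only [Finset.mem_filter, Finset.mem_univ, true_and] at ha hb
  exact hi (ha.trans hb.symm)

theorem one_le_expo {ℓ : ℕ} (i : Fin ℓ → Fin n) (k : Fin ℓ) : 1 ≤ expo i (i k) := by
  rw [expo_apply, Nat.one_le_iff_ne_zero, Finset.card_ne_zero]
  exact ⟨k, by simp⟩

theorem mem_support_expo {ℓ : ℕ} (i : Fin ℓ → Fin n) (k : Fin ℓ) : i k ∈ (expo i).support :=
  Finsupp.mem_support_iff.2 (Nat.one_le_iff_ne_zero.1 (one_le_expo i k))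

theorem expo_update {ℓ : ℕ} (i : Fin ℓ → Fin n) (k : Fin ℓ) (c : Fin n) :
    expo (Function.update i k c) = expo i - Finsupp.single (i k) 1 + Finsupp.single c 1 := by
  have h₁ : expo i = Finsupp.single (i k) 1 + ∑ l ∈ Finset.univ.erase k, Finsupp.single (i l) 1 :=
    (Finset.add_sum_erase _ _ (Finset.mem_univ k)).symm
  have h₂ : expo (Function.update i k c) =
      Finsupp.single c 1 + ∑ l ∈ Finset.univ.erase k, Finsupp.single (i l) 1 := by
    rw [expo, ← Finset.add_sum_erase _ _ (Finset.mem_univ k), Function.update_self]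
    congr 1
    exact Finset.sum_congr rfl fun l hl => by rw [Function.update_of_ne (Finset.ne_of_mem_erase hl)]
  rw [h₁, h₂, add_tsub_cancel_left, add_comm]

/-- If `i k < i' k`, then every `l` with `i' l ≤ i k` satisfies `l < k`, whereas `i l ≤ i k` holds
for all `l ≤ k`: the counts up to `i k` contradict the hypothesis. This recovers the componentwise
order from partial degrees, without tracking how a Borel move reorders indices. -/
theorem le_of_sum_expo_le {ℓ : ℕ} {i i' : Fin ℓ → Fin n} (hi : StrictMono i) (hi' : StrictMono i')
    (h : ∀ b, ∑ c ∈ Finset.Iic b, expo i c ≤ ∑ c ∈ Finset.Iic b, expo i' c) (k : Fin ℓ) :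
    i' k ≤ i k := by
  by_contra! hlt
  have hk := h (i k)
  rw [sum_expo, sum_expo] at hk
  refine absurd hk (not_le.2 (Finset.card_lt_card ⟨fun l hl => ?_, fun hsub => ?_⟩))
  · simp only [Finset.mem_filter, Finset.mem_univ, true_and, Finset.mem_Iic] at hl ⊢
    exact hi.monotone (hi'.lt_iff_lt.1 (hl.trans_lt hlt)).le
  · have hmem := hsub (x := k) (by simp)
    simp only [Finset.mem_filter, Finset.mem_univ, true_and, Finset.mem_Iic] at hmem
    exact absurd hmem (not_le.2 hlt)

/-- The index vectors of the `t`-spread monomials of degree `d` that are componentwise bounded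
by `j`. -/
def borelIndices (t : Fin (d - 1) → ℕ) (j : Fin d → Fin n) : Set (Fin d → Fin n) :=
  {i | HasGaps t le_rfl i ∧ ∀ k, i k ≤ j k}

/-- Spread monomials have degree at most `d`, so none is a proper multiple of one of degree `d`. -/
theorem eq_expo_of_isSpread_of_expo_le {t : Fin (d - 1) → ℕ} {i : Fin d → Fin n} {m : Fin n →₀ ℕ}
    (hm : IsSpread t m) (h : expo i ≤ m) : m = expo i := by
  obtain ⟨ℓ, hℓ, i', -, -, rfl⟩ := hm
  obtain ⟨b, hb⟩ := exists_add_of_le h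
  have hdeg := congrArg Finsupp.degree hb
  rw [map_add, degree_expo, degree_expo] at hdeg
  have hb0 : b = 0 := (Finsupp.degree_eq_zero_iff b).1 (by omega)
  rw [hb, hb0, add_zero]

theorem exists_hasGaps_of_isSpread {t : Fin (d - 1) → ℕ} {m : Fin n →₀ ℕ}
    (hm : IsSpread t m) (h : m.degree = d) :
    ∃ i : Fin d → Fin n, HasGaps t le_rfl i ∧ m = expo i := by
  obtain ⟨ℓ, hℓ, i, -, hg, rfl⟩ := hm
  rw [degree_expo] at h
  subst h
  exact ⟨i, hg, rfl⟩

theorem sum_Iic_le_of_lt {m : Fin n →₀ ℕ} {p q : Fin n} (hpq : p < q) (hq : q ∈ m.support)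
    (b : Fin n) : ∑ c ∈ Finset.Iic b, m c ≤
      ∑ c ∈ Finset.Iic b, (m - Finsupp.single q 1 + Finsupp.single p 1 : Fin n →₀ ℕ) c := by
  have hq' : Finsupp.single q 1 ≤ m :=
    Finsupp.single_le_iff.2 (Nat.one_le_iff_ne_zero.2 (Finsupp.mem_support_iff.1 hq))
  obtain ⟨r, rfl⟩ := exists_add_of_le hq'
  rw [add_tsub_cancel_left]
  simp only [Finsupp.add_apply, Finset.sum_add_distrib, Finsupp.single_apply]
  rw [Finset.sum_ite_eq, Finset.sum_ite_eq, add_comm]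
  refine Nat.add_le_add_left ?_ _
  simp only [Finset.mem_Iic]
  split_ifs with h₁ h₂
  · exact le_rfl
  · exact absurd (hpq.le.trans h₁) h₂
  · exact Nat.zero_le _
  · exact le_rfl

variable {K : Type*} [Field K]

theorem monomialSpan_isSpreadStronglyStable {t : Fin (d - 1) → ℕ} (ht : ∀ k, 1 ≤ t k)
    (j : Fin d → Fin n) :
    IsSpreadStronglyStable t (monomialSpan K (expo '' borelIndices t j)) := by
  refine ⟨⟨⟨_, rfl⟩, ?_⟩, ?_⟩
  · intro m hm
    rw [minGens, Set.mem_ofPred_eq] at hm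
    obtain ⟨_, ⟨i, hi, rfl⟩, hle⟩ := monomial_mem_monomialSpan_iff.1 hm.prop
    have hmi : m = expo i := le_antisymm
      (hm.le_of_le (Ideal.subset_span ⟨_, ⟨i, hi, rfl⟩, rfl⟩) hle) hle
    exact ⟨d, le_rfl, i, (hi.1.strictMono ht).monotone, hi.1, hmi⟩
  · intro m hm hmI q p hpq hq hm'
    obtain ⟨_, ⟨i, hi, rfl⟩, hle⟩ := monomial_mem_monomialSpan_iff.1 hmI
    obtain rfl := eq_expo_of_isSpread_of_expo_le hm hle
    have hdeg : (expo i - Finsupp.single q 1 + Finsupp.single p 1).degree = d := by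
      have hq' : Finsupp.single q 1 ≤ expo i :=
        Finsupp.single_le_iff.2 (Nat.one_le_iff_ne_zero.2 (Finsupp.mem_support_iff.1 hq))
      have h := congrArg Finsupp.degree (tsub_add_cancel_of_le hq')
      rw [map_add, degree_expo] at h
      rw [map_add]
      simpa using h
    obtain ⟨i', hi', heq⟩ := exists_hasGaps_of_isSpread hm' hdeg
    refine Ideal.subset_span ⟨_, ⟨i', ⟨hi', fun k => ?_⟩, rfl⟩, by rw [heq]⟩
    refine (le_of_sum_expo_le (hi.1.strictMono ht) (hi'.strictMono ht) (fun b => ?_) k).trans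
      (hi.2 k)
    rw [← heq]
    exact sum_Iic_le_of_lt hpq hq b

theorem monomial_expo_mem_of_isSpreadStronglyStable {t : Fin (d - 1) → ℕ} (ht : ∀ k, 1 ≤ t k)
    {j : Fin d → Fin n} (hj : HasGaps t le_rfl j) {L : Ideal (MvPolynomial (Fin n) K)}
    (hL : IsSpreadStronglyStable t L) (hu : monomial (expo j) (1 : K) ∈ L)
    {i : Fin d → Fin n} (hi : i ∈ borelIndices t j) : monomial (expo i) (1 : K) ∈ L := by
  -- Pass from `j` to `i` one place at a time, from the left. At the seam, `i ≤ j` only widens the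
  -- gap, so every intermediate monomial is spread.
  let h : ℕ → Fin d → Fin n := fun r k => if (k : ℕ) < r then i k else j k
  have hgap : ∀ r, HasGaps t le_rfl (h r) := by
    intro r k hk
    have h₁ := hi.1 k hk
    have h₂ := hj k hk
    have h₃ := Fin.le_def.1 (hi.2 ⟨k, by omega⟩)
    simp only [h]
    split_ifs <;> omega
  have hstep : ∀ r (hr : r < d), h (r + 1) = Function.update (h r) ⟨r, hr⟩ (i ⟨r, hr⟩) := by
    intro r hr
    funext k
    rcases eq_or_ne k ⟨r, hr⟩ with rfl | hne
    · simp [h]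
    · have : (k : ℕ) ≠ r := fun hkr => hne (Fin.ext hkr)
      rw [Function.update_of_ne hne]
      simp only [h]
      congr 1
      exact propext (by omega)
  have key : ∀ r ≤ d, monomial (expo (h r)) (1 : K) ∈ L := by
    intro r
    induction r with
    | zero => intro _; simpa [h] using hu
    | succ r ih =>
      intro hr
      have hmem := ih (by omega)
      have hspread : IsSpread t (expo (h (r + 1))) :=
        ⟨d, le_rfl, _, ((hgap _).strictMono ht).monotone, hgap _, rfl⟩
      have hle : i ⟨r, hr⟩ ≤ h r ⟨r, hr⟩ := by simpa [h] using hi.2 ⟨r, hr⟩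
      rcases hle.eq_or_lt with heq | hlt
      · rwa [hstep r hr, heq, Function.update_eq_self]
      · rw [hstep r hr, expo_update] at hspread ⊢
        exact hL.2 _ ⟨d, le_rfl, _, ((hgap _).strictMono ht).monotone, hgap _, rfl⟩ hmem _ _ hlt
          (mem_support_expo _ _) hspread
  have hd : h d = i := by
    funext k
    simp [h]
  exact hd ▸ key d le_rfl

/-- The principal `t`-spread Borel ideal `B_t(u)` of `u = x_{j₁} ⋯ x_{j_d}` is generated by the
`t`-spread monomials of degree `d` whose indices are bounded by those of `u`. -/
theorem borel_eq_monomialSpan {t : Fin (d - 1) → ℕ} (ht : ∀ k, 1 ≤ t k)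
    {j : Fin d → Fin n} (hj : HasGaps t le_rfl j) :
    borel K t (expo j) = monomialSpan K (expo '' borelIndices t j) := by
  refine le_antisymm (sInf_le ⟨monomialSpan_isSpreadStronglyStable ht j,
    Ideal.subset_span ⟨_, ⟨j, ⟨hj, fun _ => le_rfl⟩, rfl⟩, rfl⟩⟩) (le_sInf ?_)
  rintro L ⟨hL, hu⟩
  rw [monomialSpan, Ideal.span_le]
  rintro _ ⟨_, ⟨i, hi, rfl⟩, rfl⟩
  exact monomial_expo_mem_of_isSpreadStronglyStable ht hj hL hu hi

end Generators

end VectorSpread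

namespace VectorSpread

open MvPolynomial

/-! ### Max-flow min-cut on a grid -/

section Flow

/-- For vertex capacities `W k a` on `ℕ × ℕ`, the maximal number of chains
`a₀ ≤ a₁ ≤ ⋯ ≤ a_k < b` such that each vertex `(l, a)` is used at most `W l a` times. -/
def maxFlow (W : ℕ → ℕ → ℕ) : ℕ → ℕ → ℕ
  | 0, b => ∑ a ∈ Finset.range b, W 0 a
  | _ + 1, 0 => 0
  | k + 1, b + 1 => min (maxFlow W k (b + 1)) (maxFlow W (k + 1) b + W (k + 1) b)

variable (W : ℕ → ℕ → ℕ)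

theorem maxFlow_zero_right (k : ℕ) : maxFlow W k 0 = 0 := by
  cases k <;> simp [maxFlow]

theorem maxFlow_succ_le (k b : ℕ) : maxFlow W (k + 1) b ≤ maxFlow W k b := by
  cases b with
  | zero => simp [maxFlow]
  | succ b => rw [maxFlow]; exact min_le_left _ _

theorem maxFlow_antitone_left {k l : ℕ} (h : k ≤ l) (b : ℕ) : maxFlow W l b ≤ maxFlow W k b :=
  antitone_nat_of_succ_le (f := fun k => maxFlow W k b) (fun k => maxFlow_succ_le W k b) h

theorem maxFlow_succ_right_le (k b : ℕ) : maxFlow W k (b + 1) ≤ maxFlow W k b + W k b := by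
  cases k with
  | zero => rw [maxFlow, maxFlow, Finset.sum_range_succ]
  | succ k => rw [maxFlow]; exact min_le_right _ _

/-- There is a set of vertices of total capacity at most `maxFlow W k b` that meets all chains
`a₀ ≤ a₁ ≤ ⋯ ≤ a_k < b`. -/
theorem exists_cut (k b : ℕ) : ∃ C : Finset (ℕ × ℕ), ∑ x ∈ C, W x.1 x.2 ≤ maxFlow W k b ∧
    ∀ a : ℕ → ℕ, (∀ l < k, a l ≤ a (l + 1)) → a k < b → ∃ l ≤ k, (l, a l) ∈ C := by
  induction k generalizing b with
  | zero =>
    refine ⟨(Finset.range b).image fun a => (0, a), ?_, fun a _ hb => ⟨0, le_rfl, ?_⟩⟩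
    · rw [Finset.sum_image (by simp [Set.InjOn]), maxFlow]
    · simpa using hb
  | succ k ihk =>
    induction b with
    | zero => exact ⟨∅, by simp, fun a _ h => absurd h (Nat.not_lt_zero _)⟩
    | succ b ihb =>
      rw [maxFlow]
      -- The smaller term of the minimum dictates the cut: either cut already on the first `k + 1`
      -- levels, or delete the vertex `(k + 1, b)` and cut the chains ending below `b`.
      rcases le_total (maxFlow W k (b + 1)) (maxFlow W (k + 1) b + W (k + 1) b) with h | h
      · rw [min_eq_left h]
        obtain ⟨C, hC, hcut⟩ := ihk (b + 1)
        refine ⟨C, hC, fun a ha hab => ?_⟩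
        obtain ⟨l, hl, hlC⟩ := hcut a (fun l hl => ha l (by omega))
          ((ha k (by omega)).trans_lt hab)
        exact ⟨l, by omega, hlC⟩
      · rw [min_eq_right h]
        obtain ⟨C, hC, hcut⟩ := ihb
        refine ⟨insert (k + 1, b) C, ?_, fun a ha hab => ?_⟩
        · by_cases hmem : (k + 1, b) ∈ C
          · rw [Finset.insert_eq_of_mem hmem]
            exact hC.trans (Nat.le_add_right _ _)
          · rw [Finset.sum_insert hmem, add_comm]
            exact Nat.add_le_add_right hC _
        · rcases (Nat.lt_succ_iff.1 hab).eq_or_lt with hb | hb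
          · exact ⟨k + 1, le_rfl, by rw [hb]; exact Finset.mem_insert_self _ _⟩
          · obtain ⟨l, hl, hlC⟩ := hcut a ha hb
            exact ⟨l, hl, Finset.mem_insert_of_mem hlC⟩

/-- The position on level `k` of the `r`th chain in a maximal family of chains. -/
noncomputable def flowPos (k r : ℕ) : ℕ := sInf {a | r < maxFlow W k (a + 1)}

variable {W}

theorem maxFlow_flowPos_le (k r : ℕ) : maxFlow W k (flowPos W k r) ≤ r := by
  -- The case `0` also covers the default `sInf ∅ = 0`.
  rcases h : flowPos W k r with _ | q
  · rw [maxFlow_zero_right]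
    exact Nat.zero_le _
  · exact not_lt.1 (Nat.notMem_of_lt_sInf (s := {a | r < maxFlow W k (a + 1)})
      (by rw [flowPos] at h; omega))

theorem exists_lt_maxFlow_succ {k b r : ℕ} (h : r < maxFlow W k b) :
    ∃ a, r < maxFlow W k (a + 1) := by
  cases b with
  | zero => rw [maxFlow_zero_right] at h; omega
  | succ b => exact ⟨b, h⟩

theorem lt_maxFlow_flowPos {k b r : ℕ} (h : r < maxFlow W k b) :
    r < maxFlow W k (flowPos W k r + 1) :=
  Nat.sInf_mem (s := {a | r < maxFlow W k (a + 1)}) (exists_lt_maxFlow_succ h)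

/-- The flow decreases with the level, so it exceeds `r` later on level `k + 1`; this makes the
positions of each `r` a weakly increasing chain. -/
theorem flowPos_le_succ {k b r : ℕ} (h : r < maxFlow W (k + 1) b) :
    flowPos W k r ≤ flowPos W (k + 1) r :=
  Nat.sInf_le ((lt_maxFlow_flowPos h).trans_le (maxFlow_succ_le W k _))

/-- The chains through `(k, a)` are numbered by the interval from `maxFlow W k a` to `maxFlow W k (a
+ 1)`, and one step raises the flow by at most the capacity. -/
theorem card_flowPos_eq_le {k b N : ℕ} (h : N ≤ maxFlow W k b) (a : ℕ) :
    ((Finset.range N).filter fun r => flowPos W k r = a).card ≤ W k a := by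
  have hsub : ((Finset.range N).filter fun r => flowPos W k r = a) ⊆
      Finset.Ico (maxFlow W k a) (maxFlow W k (a + 1)) := by
    intro r hr
    rw [Finset.mem_filter, Finset.mem_range] at hr
    rw [Finset.mem_Ico, ← hr.2]
    exact ⟨maxFlow_flowPos_le k r, lt_maxFlow_flowPos (hr.1.trans_le h)⟩
  refine (Finset.card_le_card hsub).trans ?_
  rw [Nat.card_Ico]
  have := maxFlow_succ_right_le W k a
  omega

theorem capacity_flowPos_pos {k b r : ℕ} (h : r < maxFlow W k b) : 0 < W k (flowPos W k r) := by
  have h₁ := maxFlow_flowPos_le (W := W) k r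
  have h₂ := lt_maxFlow_flowPos h
  have h₃ := maxFlow_succ_right_le W k (flowPos W k r)
  omega

end Flow

/-! ### From flows to packings of generators: (c) implies (b) -/

section Packing

variable {n d : ℕ}

/-- The partial sum `t₁ + ⋯ + t_k`. -/
def partialSum (t : Fin (d - 1) → ℕ) (k : ℕ) : ℕ :=
  ∑ s ∈ Finset.univ.filter fun s : Fin (d - 1) => (s : ℕ) < k, t s

variable {t : Fin (d - 1) → ℕ}

theorem partialSum_zero : partialSum t 0 = 0 := by
  simp [partialSum]

theorem partialSum_succ {k : ℕ} (hk : k < d - 1) :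
    partialSum t (k + 1) = partialSum t k + t ⟨k, hk⟩ := by
  have h : (Finset.univ.filter fun s : Fin (d - 1) => (s : ℕ) < k + 1) =
      insert ⟨k, hk⟩ (Finset.univ.filter fun s : Fin (d - 1) => (s : ℕ) < k) := by
    ext s
    simp only [Finset.mem_filter, Finset.mem_univ, true_and, Finset.mem_insert, Fin.ext_iff]
    omega
  rw [partialSum, h, Finset.sum_insert (by simp), add_comm, partialSum]

theorem partialSum_mono : Monotone (partialSum t) := fun a b hab =>
  Finset.sum_le_sum_of_subset fun s hs => by
    simp only [Finset.mem_filter, Finset.mem_univ, true_and] at hs ⊢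
    omega

theorem sum_Iic_eq_partialSum (i : Fin (d - 1)) :
    ∑ s ∈ Finset.Iic i, t s = partialSum t (i + 1) := by
  refine Finset.sum_congr (Finset.ext fun s => ?_) fun _ _ => rfl
  simp only [Finset.mem_filter, Finset.mem_univ, true_and, Finset.mem_Iic, Fin.le_def]
  omega

theorem partialSum_le {i : Fin d → Fin n} (hi : HasGaps t le_rfl i) (k : Fin d) :
    partialSum t k ≤ i k := by
  obtain ⟨k, hk⟩ := k
  induction k with
  | zero => simp [partialSum_zero]
  | succ k ih =>
    have h₁ := ih (by omega)
    have h₂ := hi k hk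
    have h₃ := partialSum_succ (t := t) (k := k) (by omega)
    simp only at h₁ ⊢
    omega

/-- The capacity of the vertex `(k, a)`: the exponent of the variable with index
`t₁ + ⋯ + t_k + a` in `m`, if this index is admissible at the `k`th place. -/
def capacity (t : Fin (d - 1) → ℕ) (j : Fin d → Fin n) (m : Fin n →₀ ℕ) (k a : ℕ) : ℕ :=
  if h : ∃ hk : k < d, partialSum t k + a ≤ j ⟨k, hk⟩ then
    m ⟨partialSum t k + a, by obtain ⟨hk, h⟩ := h; omega⟩
  else 0

theorem exists_of_capacity_pos {j : Fin d → Fin n} {m : Fin n →₀ ℕ} {k a : ℕ}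
    (h : 0 < capacity t j m k a) : ∃ hk : k < d, partialSum t k + a ≤ j ⟨k, hk⟩ := by
  by_contra hcon
  rw [capacity, dif_neg hcon] at h
  exact lt_irrefl _ h

/-- The max-flow min-cut bound: if every set of variables that meets all generators of the ideal
has weight at least `N` in `m`, so does the maximal flow. -/
theorem le_maxFlow_capacity (hd : 1 ≤ d) (j : Fin d → Fin n) (m : Fin n →₀ ℕ) {N : ℕ}
    (hcov : ∀ s : Finset (Fin n), (∀ i ∈ borelIndices t j, ∃ k, i k ∈ s) → N ≤ ∑ c ∈ s, m c) :
    N ≤ maxFlow (capacity t j m) (d - 1) n := by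
  classical
  obtain ⟨C, hC, hcut⟩ := exists_cut (capacity t j m) (d - 1) n
  -- Only admissible grid vertices name a variable; the others have capacity `0` and are dropped
  -- from the cut.
  let D : Finset (ℕ × ℕ) := C.filter fun x => ∃ hk : x.1 < d, partialSum t x.1 + x.2 ≤ j ⟨x.1, hk⟩
  have hD : ∀ x : D, partialSum t x.1.1 + x.1.2 < n := by
    rintro ⟨x, hx⟩
    obtain ⟨hk, h⟩ := (Finset.mem_filter.1 hx).2
    exact h.trans_lt (j _).2
  refine (hcov (D.attach.image fun x => ⟨_, hD x⟩) fun i hi => ?_).trans (le_trans ?_ hC)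
  -- After subtracting partial sums, the gap condition says exactly that `a` is weakly increasing.
  · let a : ℕ → ℕ := fun k => if hk : k < d then (i ⟨k, hk⟩ : ℕ) - partialSum t k else 0
    have ha : ∀ k (hk : k < d), partialSum t k + a k = i ⟨k, hk⟩ := by
      intro k hk
      have := partialSum_le hi.1 ⟨k, hk⟩
      simp only [a, dif_pos hk] at this ⊢
      omega
    obtain ⟨l, hl, hlC⟩ := hcut a (fun l hl => by
      have h₁ := ha l (by omega)
      have h₂ := ha (l + 1) (by omega)
      have h₃ := hi.1 l (by omega)
      have h₄ := partialSum_succ (t := t) (k := l) (by omega)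
      omega) (by
      have h₁ := ha (d - 1) (by omega)
      have h₂ := (i ⟨d - 1, by omega⟩).2
      omega)
    have hld : l < d := by omega
    have hlD : (l, a l) ∈ D := by
      refine Finset.mem_filter.2 ⟨hlC, hld, ?_⟩
      rw [ha l hld]
      exact Fin.le_def.1 (hi.2 _)
    exact ⟨⟨l, hld⟩, Finset.mem_image.2
      ⟨⟨_, hlD⟩, Finset.mem_attach _ _, Fin.ext (ha l hld)⟩⟩
  -- Several vertices may name the same variable, which only lowers the weight of the cover; no
  -- disjointness is needed in this direction.
  · refine (Finset.sum_image_le_of_nonneg fun _ _ => Nat.zero_le _).trans ?_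
    refine le_trans (le_of_eq ?_) (Finset.sum_le_sum_of_subset
      (show D ⊆ C from Finset.filter_subset _ _))
    rw [← Finset.sum_attach D]
    refine Finset.sum_congr rfl ?_
    rintro ⟨x, hx⟩ -
    rw [capacity, dif_pos (Finset.mem_filter.1 hx).2]

/-- If `j_k ≤ t₁ + ⋯ + t_k` for `k < d`, the minimal weight in `m` of a set of variables that meets
all generators is attained by a packing of generators into `m`. -/
theorem exists_packing (hd : 1 ≤ d) {j : Fin d → Fin n}
    (hc : ∀ k (hk : k + 1 < d), (j ⟨k, by omega⟩ : ℕ) < partialSum t (k + 1))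
    (m : Fin n →₀ ℕ) {N : ℕ}
    (hcov : ∀ s : Finset (Fin n), (∀ i ∈ borelIndices t j, ∃ k, i k ∈ s) → N ≤ ∑ c ∈ s, m c) :
    ∃ i : Fin N → Fin d → Fin n, (∀ r, i r ∈ borelIndices t j) ∧ ∑ r, expo (i r) ≤ m := by
  set W := capacity t j m with hW
  have hflow : ∀ k < d, N ≤ maxFlow W k n := fun k hk =>
    (le_maxFlow_capacity hd j m hcov).trans (maxFlow_antitone_left W (by omega) n)
  have hpos : ∀ (r : Fin N) (k : Fin d), partialSum t k + flowPos W k r ≤ j k := by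
    intro r k
    obtain ⟨_, h⟩ := exists_of_capacity_pos
      (capacity_flowPos_pos (r.2.trans_le (hflow k k.2)))
    exact h
  refine ⟨fun r k => ⟨partialSum t k + flowPos W k r, (hpos r k).trans_lt (j k).2⟩,
    fun r => ⟨fun k hk => ?_, fun k => Fin.le_def.2 (hpos r k)⟩, fun x => ?_⟩
  · have h₁ := flowPos_le_succ (r.2.trans_le (hflow (k + 1) hk))
    have h₂ := partialSum_succ (t := t) (k := k) (by omega)
    simp only
    omega
  · rw [Finsupp.finsetSum_apply]
    simp only [expo_apply, Finset.card_filter, Fin.ext_iff]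
    rw [Finset.sum_comm]
    by_cases hex : ∃ (r : Fin N) (k : Fin d), partialSum t k + flowPos W k r = x
    · obtain ⟨r₀, k₀, h₀⟩ := hex
      have huniq : ∀ k : Fin d, k ≠ k₀ →
          ∑ r : Fin N, (if partialSum t k + flowPos W k r = x then 1 else 0) = 0 := by
        intro k hk
        refine Finset.sum_eq_zero fun r _ => if_neg fun h => ?_
        -- Place `l` uses indices from `partialSum t l` to below `partialSum t (l + 1)`, by `hc`
        -- when it is not the last place. These blocks are disjoint, so a variable occurs at only
        -- one place and its exponent is not shared between levels.
        have hlt : ∀ (r r' : Fin N) (l l' : Fin d), l < l' →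
            partialSum t l + flowPos W l r ≠ partialSum t l' + flowPos W l' r' := by
          intro r r' l l' hll
          have h₁ := hpos r l
          have h₂ := hc l (by omega)
          have h₃ := partialSum_mono (t := t) (show (l : ℕ) + 1 ≤ l' from hll)
          simp only [Fin.eta] at h₂
          omega
        rcases lt_or_gt_of_ne hk with hlt' | hlt'
        · exact hlt r r₀ k k₀ hlt' (h.trans h₀.symm)
        · exact hlt r₀ r k₀ k hlt' (h₀.trans h.symm)
      rw [Finset.sum_eq_single k₀ (fun k _ hk => huniq k hk) (by simp)]
      have hcap : W k₀ (flowPos W k₀ r₀) = m x := by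
        conv_lhs => rw [hW]
        rw [capacity, dif_pos ⟨k₀.2, hpos r₀ k₀⟩]
        exact congrArg m (Fin.ext h₀)
      rw [← hcap]
      refine le_trans (le_of_eq ?_) (card_flowPos_eq_le (hflow k₀ k₀.2) _)
      rw [Finset.card_filter, Finset.sum_range]
      refine Finset.sum_congr rfl fun r _ => ?_
      congr 1
      exact propext (by omega)
    · push Not at hex
      rw [Finset.sum_eq_zero fun k _ => Finset.sum_eq_zero fun r _ => if_neg (hex r k)]
      exact Nat.zero_le _

variable {K : Type*} [Field K]

theorem monomial_mem_monomialSpan_pow {A : Set (Fin n →₀ ℕ)} {N : ℕ} {a : Fin N → Fin n →₀ ℕ}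
    (ha : ∀ r, a r ∈ A) {m : Fin n →₀ ℕ} (h : ∑ r, a r ≤ m) :
    monomial m (1 : K) ∈ monomialSpan K A ^ N := by
  refine monomial_mem_of_le ?_ h
  rw [monomial_sum_one]
  have := Ideal.prod_mem_prod (s := Finset.univ) (I := fun _ : Fin N => monomialSpan K A)
    (x := fun r => monomial (a r) (1 : K)) fun r _ => Ideal.subset_span ⟨_, ha r, rfl⟩
  simpa using this

/-- A set of variables meeting all generators generates a prime containing a minimal prime. Every
monomial of an element of the symbolic power therefore has weight at least `N` on it, which is the
covering hypothesis of `exists_packing`. -/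
theorem iInf_minimalPrimes_pow_le_of_lt_partialSum (hd : 1 ≤ d) {j : Fin d → Fin n}
    (hc : ∀ k (hk : k + 1 < d), (j ⟨k, by omega⟩ : ℕ) < partialSum t (k + 1)) (N : ℕ) :
    ⨅ P ∈ (monomialSpan K (expo '' borelIndices t j)).minimalPrimes, P ^ N ≤
      monomialSpan K (expo '' borelIndices t j) ^ N := by
  intro f hf
  rw [f.as_sum]
  refine Ideal.sum_mem _ fun m hm => ?_
  obtain ⟨i, hi, hle⟩ := exists_packing (t := t) hd hc m (N := N) fun s hs => by
    have hsle : monomialSpan K (expo '' borelIndices t j) ≤ varIdeal K s := by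
      refine monomialSpan_le_varIdeal ?_
      rintro _ ⟨i, hi, rfl⟩
      obtain ⟨k, hk⟩ := hs i hi
      exact ⟨i k, hk, one_le_expo i k⟩
    have := varIdeal_isPrime (K := K) s
    obtain ⟨P, hP, hPs⟩ := Ideal.exists_minimalPrimes_le hsle
    simp only [Submodule.mem_iInf] at hf
    exact le_sum_of_mem_varIdeal_pow (Ideal.pow_right_mono hPs N (hf P hP)) hm
  have hmem := monomial_mem_monomialSpan_pow (K := K) (fun r => Set.mem_image_of_mem expo (hi r)) hle
  rw [← mul_one (coeff m f), ← C_mul_monomial]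
  exact Ideal.mul_mem_left _ _ hmem

end Packing

end VectorSpread

namespace VectorSpread

open MvPolynomial

/-! ### Failure of (c) produces a low-degree element of the symbolic square -/

section SymbolicSquare

/-- If `m ∉ P`, the prime meets each pair among `p, q, r`, hence contains two of them. -/
theorem mul_mem_sq_of_isPrime {R : Type*} [CommRing R] {P : Ideal R} (hP : P.IsPrime)
    {m p q r : R} (hqr : m * q * r ∈ P) (hpr : m * p * r ∈ P) (hpq : m * p * q ∈ P) :
    m * m * (p * q * r) ∈ P ^ 2 := by
  rw [sq]
  by_cases hm : m ∈ P
  · exact Ideal.mul_mem_right _ _ (Ideal.mul_mem_mul hm hm)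
  have key : ∀ {a b : R}, m * a * b ∈ P → a ∈ P ∨ b ∈ P := fun h =>
    hP.mem_or_mem ((hP.mem_or_mem (mul_assoc m _ _ ▸ h)).resolve_left hm)
  refine Ideal.mul_mem_left _ _ ?_
  have h₁ := key hqr
  have h₂ := key hpr
  have h₃ := key hpq
  by_cases hp : p ∈ P
  · rw [mul_assoc]
    refine Ideal.mul_mem_mul hp ?_
    rcases h₁ with h | h
    · exact Ideal.mul_mem_right _ _ h
    · exact Ideal.mul_mem_left _ _ h
  · rw [mul_assoc]
    exact Ideal.mul_mem_left _ _ (Ideal.mul_mem_mul (h₃.resolve_left hp) (h₂.resolve_left hp))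

variable {n d : ℕ} {t : Fin (d - 1) → ℕ} {K : Type*} [Field K]

/-- The slack `t c` over the smallest possible index, once present at place `c`, persists because
later gaps of `j` are at least those of the partial sums. -/
theorem partialSum_add_le {j : Fin d → Fin n} (hj : HasGaps t le_rfl j) (c : Fin (d - 1))
    (hc : partialSum t (c + 1) ≤ j ⟨c, by omega⟩) {k : ℕ} (hck : c ≤ k) (hk : k < d) :
    partialSum t k + t c ≤ j ⟨k, hk⟩ := by
  induction k, hck using Nat.le_induction with
  | base => exact (partialSum_succ c.2).symm.trans_le hc
  | succ k hck ih =>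
    have h₁ := ih (by omega)
    have h₂ := hj k hk
    have h₃ := partialSum_succ (t := t) (k := k) (by omega)
    omega

theorem monomialSpan_borelIndices_pow_le (j : Fin d → Fin n) (N : ℕ) :
    monomialSpan K (expo '' borelIndices t j) ^ N ≤ varIdeal K Finset.univ ^ (d * N) := by
  rw [pow_mul]
  refine Ideal.pow_right_mono ?_ N
  rw [monomialSpan, Ideal.span_le]
  rintro _ ⟨_, ⟨i, -, rfl⟩, rfl⟩
  refine monomial_mem_varIdeal_pow _ ?_
  rw [← Finsupp.degree_eq_sum, degree_expo]

/-- If `j_c > t₁ + ⋯ + t_c` for some `c < d`, the second symbolic power contains a monomial of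
degree `2d - 1`. -/
theorem lt_partialSum_of_iInf_minimalPrimes_sq_le {j : Fin d → Fin n} (hj : HasGaps t le_rfl j)
    (h : ⨅ P ∈ (monomialSpan K (expo '' borelIndices t j)).minimalPrimes, P ^ 2 ≤
      monomialSpan K (expo '' borelIndices t j) ^ 2) (c : Fin (d - 1)) :
    (j ⟨c, by omega⟩ : ℕ) < partialSum t (c + 1) := by
  by_contra! hc
  have hle : ∀ (e : ℕ) (k : Fin d), partialSum t k + (if c + e ≤ k then t c else 0) ≤ j k := by
    intro e k
    split_ifs with hek
    · exact partialSum_add_le hj c hc (by omega) k.2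
    · exact partialSum_le hj k
  -- The smallest spread monomial, with all places from `c + e` on shifted by `t c`. For `e = 0, 1,
  -- 2` these differ only at places `c` and `c + 1`. With `p, q, r` the variables of index
  -- `partialSum t c` plus `0`, `t c` and `2 * t c`, the three monomials are `μqr`, `μpr` and `μpq`.
  let v : ℕ → Fin d → Fin n := fun e k =>
    ⟨partialSum t k + (if c + e ≤ k then t c else 0), (hle e k).trans_lt (j k).2⟩
  have hv : ∀ e, v e ∈ borelIndices t j := by
    refine fun e => ⟨fun k hk => ?_, fun k => Fin.le_def.2 (hle e k)⟩
    have h₁ := partialSum_succ (t := t) (k := k) (by omega)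
    simp only [v]
    split_ifs <;> omega
  let k₀ : Fin d := ⟨c, by omega⟩
  let k₁ : Fin d := ⟨c + 1, by omega⟩
  have hne : k₁ ≠ k₀ := by simp [k₀, k₁]
  let μ : Fin n →₀ ℕ := ∑ k ∈ (Finset.univ.erase k₀).erase k₁, Finsupp.single (v 0 k) 1
  have hexpo : ∀ e ≤ 2,
      expo (v e) = μ + Finsupp.single (v e k₀) 1 + Finsupp.single (v e k₁) 1 := by
    intro e he
    rw [expo, ← Finset.add_sum_erase _ _ (Finset.mem_univ k₀),
      ← Finset.add_sum_erase _ _ (Finset.mem_erase.2 ⟨hne, Finset.mem_univ k₁⟩)]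
    have hsum : ∑ k ∈ (Finset.univ.erase k₀).erase k₁, Finsupp.single (v e k) 1 = μ := by
      refine Finset.sum_congr rfl fun k hk => ?_
      congr 1
      simp only [Finset.mem_erase, Finset.mem_univ, and_true, ne_eq, Fin.ext_iff, k₀, k₁] at hk
      simp only [v]
      congr 3
      exact propext (by omega)
    rw [hsum]
    abel
  have hp : v 2 k₀ = v 1 k₀ := by simp [v, k₀]
  have hr : v 1 k₁ = v 0 k₁ := by simp [v, k₁]
  -- Shifting by exactly `t c` makes the shifted place `c` coincide with the unshifted place `c +
  -- 1`.
  have hq : v 2 k₁ = v 0 k₀ := by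
    have := partialSum_succ (t := t) c.2
    simp [v, k₀, k₁, this]
  have hmem : ∀ e ≤ 2, monomial μ (1 : K) * X (v e k₀) * X (v e k₁) ∈
      monomialSpan K (expo '' borelIndices t j) := by
    intro e he
    have : monomial (expo (v e)) (1 : K) ∈ monomialSpan K (expo '' borelIndices t j) :=
      Ideal.subset_span ⟨_, ⟨_, hv e, rfl⟩, rfl⟩
    rw [hexpo e he] at this
    simpa only [X, monomial_mul, one_mul] using this
  let f : MvPolynomial (Fin n) K := monomial (μ + μ + (Finsupp.single (v 1 k₀) 1 +
    Finsupp.single (v 0 k₀) 1 + Finsupp.single (v 0 k₁) 1)) 1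
  have hf : f = monomial μ 1 * monomial μ 1 * (X (v 1 k₀) * X (v 0 k₀) * X (v 0 k₁)) := by
    simp only [f, X, monomial_mul, one_mul]
  have hfmem : f ∈ monomialSpan K (expo '' borelIndices t j) ^ 2 := by
    refine h ?_
    simp only [Submodule.mem_iInf]
    intro P hP
    rw [hf]
    refine mul_mem_sq_of_isPrime hP.1.1 (hP.1.2 (hmem 0 (by omega))) (hP.1.2 ?_) (hP.1.2 ?_)
    · have := hmem 1 (by omega)
      rwa [hr] at this
    · have := hmem 2 le_rfl
      rwa [hp, hq] at this
  -- Elements of the square have order at least `2d`, but `μ` has degree `d - 2`, so this monomial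
  -- has degree `2(d - 2) + 3`.
  have hdeg := le_sum_of_mem_varIdeal_pow (monomialSpan_borelIndices_pow_le j 2 hfmem)
    (m := μ + μ + (Finsupp.single (v 1 k₀) 1 + Finsupp.single (v 0 k₀) 1 +
      Finsupp.single (v 0 k₁) 1)) (by simp [f, mem_support_iff])
  have hμ := congrArg Finsupp.degree (hexpo 0 (by omega))
  rw [degree_expo] at hμ
  rw [← Finsupp.degree_eq_sum] at hdeg
  simp only [map_add, Finsupp.degree_single] at hμ hdeg
  omega

end SymbolicSquare

end VectorSpread

/-! ### The equivalence, closed as (a) ⇒ (c) ⇒ (b) ⇒ (a) -/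

open VectorSpread in
theorem mainTheorem3 {K : Type*} [Field K] {n d : ℕ} (hd : 2 ≤ d)
    (t : Fin (d - 1) → ℕ) (ht : ∀ k, 1 ≤ t k)
    (j : Fin d → Fin n) (hj : StrictMono j) (hgap : VectorSpread.HasGaps t le_rfl j)
    (hlast : (j ⟨d - 1, by omega⟩ : ℕ) + 1 = n)
    (I : Ideal (MvPolynomial (Fin n) K))
    (hI : I = VectorSpread.borel K t (VectorSpread.expo j)) :
    List.TFAE [
      VectorSpread.NormallyTorsionfree I,
      ∀ k : ℕ, 1 ≤ k → VectorSpread.symbolicPower I k = I ^ k,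
      ∀ i : Fin (d - 1), (j ⟨i, by omega⟩ : ℕ) + 1 ≤ ∑ s ∈ Finset.Iic i, t s] := by
  rw [borel_eq_monomialSpan ht hgap] at hI
  subst hI
  tfae_have 1 → 3 := by
    intro h i
    rw [sum_Iic_eq_partialSum]
    -- Only the second power is needed here. With indices starting at `0`, condition (c) is the
    -- strict inequality `j i < partialSum t (i + 1)`.
    refine lt_partialSum_of_iInf_minimalPrimes_sq_le (K := K) hgap
      (iInf_minimalPrimes_pow_le_pow (monomialSpan_isRadical ?_) (h 2 (by omega))) i
    rintro _ ⟨i, hi, rfl⟩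
    exact expo_le_one (hi.1.strictMono ht).injective
  tfae_have 3 → 2 := by
    intro h k _
    refine le_antisymm (iInf_minimalPrimes_pow_le_of_lt_partialSum (by omega) (fun i hi => ?_) k)
      (le_iInf₂ fun P hP => Ideal.pow_right_mono hP.1.2 k)
    have := h ⟨i, by omega⟩
    rwa [sum_Iic_eq_partialSum] at this
  tfae_have 2 → 1 := fun h k hk => associatedPrimes_pow_subset_of_iInf_pow_le (h k hk).le
  tfae_finish
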